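/- Let $\Sigma$ be a (many-sorted) signature consisting of function symbols of arbitrary arity, and work in the empty $\Sigma$-theory (EUF); all terms and equations are well-sorted. Let $\underline e,\underline y$ be disjoint finite tuples of variables. A quantifier-free formula $\psi(\underline y)$ is a *cover* of $\exists\underline e\,\phi(\underline e,\underline y)$ if $\phi(\underline e,\underline y)\to\psi(\underline y)$ is valid and, for every quantifier-free $\theta(\underline y,\underline z)$ such that $\phi(\underline e,\underline y)\to\theta(\underline y,\underline z)$ is valid, $\psi(\underline y)\to\theta(\underline y,\underline z)$ is valid too. **Flatness.** An expression is $\underline e$-free if no variable of $\underline e$ occurs in it. An $\underline e$-flat term is an $\underline e$-free term, a variable from $\underline e$, or a term $f(u_1,\dots,u_n)$ where each $u_i$ is $\underline e$-free or a variable from $\underline e$. An $\underline e$-flat literal has the form $t=a$ or $a\neq b$, with $t$ an $\underline e$-flat term and $a,b$ either $\underline e$-free or variables from $\underline e$. (Dis)equations are unordered pairs of terms, and $\equiv$ is syntactic identity. **Ordering.** Regard $\underline e,\underline y$ as free constants. Let $>$ be a reduction ordering (a well-founded strict order compatible with the function symbols), total on ground terms, such that $t>a$ whenever $t$ is an $\underline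 e$-flat term that is not $\underline e$-free and either (i) $a$ is $\underline e$-free, or (ii) $t$ is not a variable from $\underline e$ and $a$ is a variable from $\underline e$. **Calculus.** For $\underline e$-flat $t,u$ define $E(t,u)$ by: $E(t,u)=\emptyset$ if $t\equiv u$; $E(t,u)=\{t=u\}$ if $t\not\equiv u$ are both $\underline e$-free; $E(t,u)=\bigcup_i E(t_i,u_i)$ if $t\equiv f(t_1,\dots,t_k)$ and $u\equiv f(u_1,\dots,u_k)$ are both not $\underline e$-free and no $E(t_i,u_i)$ fails; in all other cases $E(t,u)$ fails. A constrained literal $L\,\Vert\,C$ consists of a literal $L$ (or the empty clause $\bot$) and a finite set $C$ of equations between $\underline e$-free terms; it stands for the clause $\bigwedge C\to L$, and it is called $\underline e$-free if $L$ is. The inference rules, applied only when $E$ does not fail and no premise is $\underline e$-free, are: - Superposition Right: from $l=r\,\Vert\,C$ and $s=t\,\Vert\,D$ with $l>r$, $s>t$, infer $s[r]_p=t\,\Vert\,C\cup D\cup E(s_{|p},l)$. - Superposition Left: from $l=r\,\Vert\,C$ and $s\ne t\,\Vert\,D$ with $l>r$, $s>t$, infer $s[r]_p\ne t\,\Vert\,C\cup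 D\cup E(s_{|p},l)$. - Reflexion: from $t\neq u\,\Vert\,C$ infer $\bot\,\Vert\,C\cup E(t,u)$. The simplification rule Demodulation replaces $L\,\Vert\,C$ by $L[t]_p\,\Vert\,C$ when $e_j=t\,\Vert\,D$ is in the current set, $t$ is $\underline e$-free, $D\subseteq C$ and $L_{|p}\equiv e_j$; if $L\,\Vert\,C$ itself is of the form $e_j=t_1\,\Vert\,D$ with $t_1$ $\underline e$-free (same $e_j$ and same $D$), this is allowed only if $t_1>t$. **Algorithm.** For a conjunction $\phi(\underline e,\underline y)$ of $\underline e$-flat literals, start from the set of all $L\,\Vert\,\emptyset$ with $L$ a literal of $\phi$. At each step apply, non-deterministically, either a Demodulation (the conclusion is added, the first premise is removed; Demodulations whose two premises both have the form $e_j=t\,\Vert\,D$ with $t$ $\underline e$-free have priority over the others) or, only if no Demodulation is applicable, an inference rule (the conclusion is added). A set $S$ is *saturated* if every constrained literal that an inference rule produces from premises in $S$ is already in $S$ after having been exhaustively simplified by Demodulation with elements of $S$. When a saturated set $S$ is reached, the algorithm outputs the conjunction $\psi(\underline y)$ of the clauses $\bigwedge C\to L$, for all $\underline e$-free $L\,\Vert\,C$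 in $S$. **Theorem.** If the algorithm, taking as input the primitive $\underline e$-flat formula $\exists\underline e\,\phi(\underline e,\underline y)$, gives as output the quantifier-free formula $\psi(\underline y)$, then $\psi(\underline y)$ is a cover of $\exists\underline e\,\phi(\underline e,\underline y)$. -/

import Mathlib

universe u w

namespace CSC

/-! ### Many-sorted terms, structures and quantifier-free formulae -/

/-- A many-sorted functional signature with set of sorts `S`: `Fn d s` is the set of function
symbols with `n` arguments of sorts `d 0, …, d (n - 1)` and with values of sort `s`. -/
structure Signature (S : Type u) where
  Fn : {n : ℕ} → (Fin n → S) → S → Type u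

/-- Well-sorted terms over a sorted family `X` of variables (or of free constants). -/
inductive Term {S : Type u} (Sg : Signature S) (X : S → Type w) : S → Type (max u w)
  | var {s : S} (x : X s) : Term Sg X s
  | app {n : ℕ} {d : Fin n → S} {s : S} (f : Sg.Fn d s) (ts : ∀ i, Term Sg X (d i)) : Term Sg X s

/-- Structures (all sorts are non-empty). -/
structure Struc {S : Type u} (Sg : Signature S) where
  Carrier : S → Type u
  nonempty : ∀ s, Nonempty (Carrier s)
  fn : {n : ℕ} → {d : Fin n → S} → {s : S} → Sg.Fn d s → (∀ i, Carrier (d i)) → Carrier s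

variable {S : Type u} {Sg : Signature S}

/-- Renaming of variables. -/
def Term.map {X X' : S → Type w} (ρ : ∀ s, X s → X' s) : {s : S} → Term Sg X s → Term Sg X' s
  | _, .var x => .var (ρ _ x)
  | _, .app f ts => .app f (fun i => (ts i).map ρ)

/-- Value of a term in a structure under an assignment. -/
def Term.eval {X : S → Type w} (M : Struc Sg) (I : ∀ s, X s → M.Carrier s) :
    {s : S} → Term Sg X s → M.Carrier s
  | _, .var x => I _ x
  | _, .app f ts => M.fn f (fun i => (ts i).eval M I)

/-- Quantifier-free formulae. -/
inductive QF {S : Type u} (Sg : Signature S) (X : S → Type w) : Type (max u w)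
  | eq {s : S} (t t' : Term Sg X s) : QF Sg X
  | bot : QF Sg X
  | and (φ χ : QF Sg X) : QF Sg X
  | imp (φ χ : QF Sg X) : QF Sg X

namespace QF

variable {X : S → Type w}

def neg (φ : QF Sg X) : QF Sg X := .imp φ .bot

def top : QF Sg X := .imp .bot .bot

/-- Finite conjunctions. -/
def conj : List (QF Sg X) → QF Sg X
  | [] => top
  | φ :: l => .and φ (conj l)

/-- Truth of a formula in a structure under an assignment. -/
def Holds (M : Struc Sg) (I : ∀ s, X s → M.Carrier s) : QF Sg X → Prop
  | .eq t t' => t.eval M I = t'.eval M I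
  | .bot => False
  | .and φ χ => φ.Holds M I ∧ χ.Holds M I
  | .imp φ χ => φ.Holds M I → χ.Holds M I

end QF

/-- The variables from two disjoint families. -/
abbrev Vars (E Y : S → Type) : S → Type := fun s => E s ⊕ Y s

/-- Simultaneous assignment to two disjoint families of variables. -/
def joint {E Y : S → Type} {M : S → Type u} (I : ∀ s, E s → M s) (J : ∀ s, Y s → M s) :
    ∀ s, Vars E Y s → M s :=
  fun s => Sum.elim (I s) (J s)

/-! ### Covers in the empty theory (EUF) -/

section Cover

variable {E Y : S → Type}

/-- `θ(y, z)` is a residue of `∃ e, φ(e, y)`: the implication `φ(e, y) → θ(y, z)` is true in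
all structures under all assignments. The further variables `z` are taken from an unlimited supply
(a copy of `ℕ` in each sort). -/
def IsResidue (φ : QF Sg (Vars E Y)) (θ : QF Sg (Vars Y (fun _ => ℕ))) : Prop :=
  ∀ (M : Struc Sg) (I : ∀ s, E s → M.Carrier s) (J : ∀ s, Y s → M.Carrier s)
    (K : ∀ s : S, ℕ → M.Carrier s),
    φ.Holds M (joint I J) → θ.Holds M (joint J K)

/-- `ψ(y)` is a cover of `∃ e, φ(e, y)`: it is itself a residue, and it implies every residue. -/
def IsCover (φ : QF Sg (Vars E Y)) (ψ : QF Sg Y) : Prop :=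
  (∀ (M : Struc Sg) (I : ∀ s, E s → M.Carrier s) (J : ∀ s, Y s → M.Carrier s),
    φ.Holds M (joint I J) → ψ.Holds M J) ∧
  ∀ θ : QF Sg (Vars Y (fun _ => ℕ)), IsResidue φ θ →
    ∀ (M : Struc Sg) (J : ∀ s, Y s → M.Carrier s) (K : ∀ s : S, ℕ → M.Carrier s),
      ψ.Holds M J → θ.Holds M (joint J K)

end Cover

/-! ### Literals and constrained literals

Equalities and disequalities are unordered pairs of terms of the same sort. The variables
`e` and `y` are treated as free constants, so that all terms are regarded as ground. -/

/-- Literals, together with the empty clause `⊥`. -/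
inductive Lit {S : Type u} (Sg : Signature S) (X : S → Type w) : Type (max u w)
  | eq {s : S} (p : Sym2 (Term Sg X s)) : Lit Sg X
  | ne {s : S} (p : Sym2 (Term Sg X s)) : Lit Sg X
  | bot : Lit Sg X

def Lit.map {X X' : S → Type w} (ρ : ∀ s, X s → X' s) : Lit Sg X → Lit Sg X'
  | .eq p => .eq (p.map (Term.map ρ))
  | .ne p => .ne (p.map (Term.map ρ))
  | .bot => .bot

/-- The formula `t = t'` for an unordered pair `{t, t'}` (written in some order). -/
noncomputable def eqFormula {X : S → Type w} {s : S} (p : Sym2 (Term Sg X s)) : QF Sg X :=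
  .eq (Quot.out p).1 (Quot.out p).2

noncomputable def Lit.toQF {X : S → Type w} : Lit Sg X → QF Sg X
  | .eq p => eqFormula p
  | .ne p => (eqFormula p).neg
  | .bot => .bot

/-- A constraint: a finite set (read as a conjunction) of equalities between `e`-free terms, that
is, between terms in the parameters `y`. -/
abbrev Constraint (Sg : Signature S) (Y : S → Type) : Type u := Finset (Σ s, Sym2 (Term Sg Y s))

/-- Constrained literals `L ‖ C`, the variables of `L` being taken from `X`, those of `C` from
`Y`. -/
@[ext]
structure CLit {S : Type u} (Sg : Signature S) (X Y : S → Type) where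
  lit : Lit Sg X
  con : Constraint Sg Y

/-- The Horn clause `⋀ C → L` expressed by `L ‖ C`, if `L` is a literal in the parameters `y`. -/
noncomputable def CLit.clause {Y : S → Type} (K : CLit Sg Y Y) : QF Sg Y :=
  .imp (.conj (K.con.toList.map fun p => eqFormula p.2)) K.lit.toQF

section Calculus

variable {E Y : S → Type}

/-- A term in the parameters `y`, seen as a term in the variables `e, y`. -/
def Term.ofPar {s : S} (t : Term Sg Y s) : Term Sg (Vars E Y) s := t.map fun _ => Sum.inr

/-- The existential variables do not occur in the term. -/
def Term.EFree {s : S} (t : Term Sg (Vars E Y) s) : Prop := ∃ t' : Term Sg Y s, t = t'.ofPar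

/-- An existential variable, as a term. -/
def evar {s : S} (e : E s) : Term Sg (Vars E Y) s := .var (Sum.inl e)

/-- The term is one of the existential variables. -/
def Term.IsEVar {s : S} (t : Term Sg (Vars E Y) s) : Prop := ∃ e : E s, t = evar e

/-- Terms that are `e`-free or variables from `e`. -/
def Term.IsSimple {s : S} (t : Term Sg (Vars E Y) s) : Prop := t.EFree ∨ t.IsEVar

/-- `e`-flat terms. -/
inductive Term.EFlat : {s : S} → Term Sg (Vars E Y) s → Prop
  | simple {s : S} {t : Term Sg (Vars E Y) s} : t.IsSimple → t.EFlat
  | app {n : ℕ} {d : Fin n → S} {s : S} (f : Sg.Fn d s) (us : ∀ i, Term Sg (Vars E Y) (d i)) :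
      (∀ i, (us i).IsSimple) → (Term.app f us).EFlat

/-- `e`-flat literals: `t = a` and `a ≠ b` with `t` an `e`-flat term and with `a, b` either `e`-free
terms or variables from `e`. -/
inductive Lit.EFlat : Lit Sg (Vars E Y) → Prop
  | eq {s : S} (t a : Term Sg (Vars E Y) s) : t.EFlat → a.IsSimple → (Lit.eq s(t, a)).EFlat
  | ne {s : S} (a b : Term Sg (Vars E Y) s) : a.IsSimple → b.IsSimple → (Lit.ne s(a, b)).EFlat

/-- A literal in the parameters `y`, seen as a literal in the variables `e, y`. -/
def Lit.ofPar (L : Lit Sg Y) : Lit Sg (Vars E Y) := L.map fun _ => Sum.inr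

/-- The existential variables do not occur in the literal. -/
def Lit.EFree (L : Lit Sg (Vars E Y)) : Prop := ∃ L' : Lit Sg Y, L = L'.ofPar

def CLit.ofPar (K : CLit Sg Y Y) : CLit Sg (Vars E Y) Y := ⟨K.lit.ofPar, K.con⟩

theorem Term.ofPar_injective {s : S} :
    Function.Injective (Term.ofPar : Term Sg Y s → Term Sg (Vars E Y) s) := by
  intro t
  induction t with
  | var x =>
    intro t' h
    cases t' with
    | var x' => simpa [Term.ofPar, Term.map] using h
    | app f ts => simp [Term.ofPar, Term.map] at h
  | app f ts ih =>
    intro t' h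
    cases t' with
    | var x' => simp [Term.ofPar, Term.map] at h
    | app f' ts' =>
      simp only [Term.ofPar, Term.map, Term.app.injEq] at h
      obtain ⟨rfl, h⟩ := h
      obtain ⟨rfl, h⟩ := h
      obtain ⟨h1, h2⟩ := h
      obtain rfl := eq_of_heq h1
      have h3 := eq_of_heq h2
      congr 1
      funext i
      exact ih i (congrFun h3 i)

theorem Lit.ofPar_injective :
    Function.Injective (Lit.ofPar : Lit Sg Y → Lit Sg (Vars E Y)) := by
  have key : ∀ {s : S} (p q : Sym2 (Term Sg Y s)),
      p.map (Term.map fun _ => Sum.inr) = q.map (Term.map fun _ => (Sum.inr : _ → Vars E Y _)) →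
      p = q := fun p q h => Sym2.map.injective Term.ofPar_injective h
  intro L L' h
  cases L <;> cases L' <;> simp only [Lit.ofPar, Lit.map, reduceCtorEq] at h ⊢
  all_goals
    injection h with h1 h2
    subst h1
    rw [key _ _ (eq_of_heq h2)]

theorem CLit.ofPar_injective :
    Function.Injective (CLit.ofPar : CLit Sg Y Y → CLit Sg (Vars E Y) Y) := by
  intro K K' h
  simp only [CLit.ofPar, CLit.mk.injEq] at h
  exact CLit.ext (Lit.ofPar_injective h.1) h.2

/-! ### Positions, orderings and the procedure `E(t, u)` -/

/-- `Repl u v s s'`: there is a position `p` such that `s|ₚ` is `u` and `s'` is `s[v]ₚ`. -/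
inductive Repl {σ : S} (u v : Term Sg (Vars E Y) σ) :
    {τ : S} → Term Sg (Vars E Y) τ → Term Sg (Vars E Y) τ → Prop
  | root : Repl u v u v
  | arg {n : ℕ} {d : Fin n → S} {τ : S} (f : Sg.Fn d τ) (ts : ∀ i, Term Sg (Vars E Y) (d i))
      (i : Fin n) (t' : Term Sg (Vars E Y) (d i)) : Repl u v (ts i) t' →
      Repl u v (.app f ts) (.app f (Function.update ts i t'))

/-- The same for literals: replacement of one occurrence of `u` by `v`. -/
inductive LitRepl {σ : S} (u v : Term Sg (Vars E Y) σ) :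
    Lit Sg (Vars E Y) → Lit Sg (Vars E Y) → Prop
  | eq {τ : S} {s s' : Term Sg (Vars E Y) τ} (t : Term Sg (Vars E Y) τ) : Repl u v s s' →
      LitRepl u v (.eq s(s, t)) (.eq s(s', t))
  | ne {τ : S} {s s' : Term Sg (Vars E Y) τ} (t : Term Sg (Vars E Y) τ) : Repl u v s s' →
      LitRepl u v (.ne s(s, t)) (.ne s(s', t))

/-- `gt s t t'` says that `t > t'`, for terms `t, t'` of sort `s`. -/
abbrev TermRel (Sg : Signature S) (E Y : S → Type) : Type u :=
  ∀ s : S, Term Sg (Vars E Y) s → Term Sg (Vars E Y) s → Prop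

/-- A reduction ordering, total on (ground) terms of the same sort. -/
structure IsReductionOrdering (gt : TermRel Sg E Y) : Prop where
  irrefl : ∀ s t, ¬ gt s t t
  trans : ∀ s t₁ t₂ t₃, gt s t₁ t₂ → gt s t₂ t₃ → gt s t₁ t₃
  wf : ∀ s, WellFounded fun t t' => gt s t' t
  total : ∀ s t t', t ≠ t' → gt s t t' ∨ gt s t' t
  compat : ∀ {n : ℕ} {d : Fin n → S} {s : S} (f : Sg.Fn d s) (ts : ∀ i, Term Sg (Vars E Y) (d i))
    (i : Fin n) (t t' : Term Sg (Vars E Y) (d i)), gt (d i) t t' →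
    gt s (.app f (Function.update ts i t)) (.app f (Function.update ts i t'))

/-- The ordering orients `e`-flat equalities `t = a` from left to right if `t` is not `e`-free and `a`
is `e`-free, or if `t` is neither `e`-free nor a variable from `e` and `a` is a variable from `e`. -/
structure OrientsFlat (gt : TermRel Sg E Y) : Prop where
  toFree : ∀ s t a, t.EFlat → ¬ t.EFree → a.EFree → gt s t a
  toEVar : ∀ s t a, t.EFlat → ¬ t.EFree → ¬ t.IsEVar → a.IsEVar → gt s t a

open Classical in
/-- `EProc t u C`: the procedure `E(t, u)` does not fail, and its result is the constraint `C`. -/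
inductive EProc : {s : S} → Term Sg (Vars E Y) s → Term Sg (Vars E Y) s → Constraint Sg Y → Prop
  | same {s : S} (t : Term Sg (Vars E Y) s) : EProc t t ∅
  | free {s : S} (t u : Term Sg Y s) : t ≠ u → EProc t.ofPar u.ofPar {⟨s, s(t, u)⟩}
  | app {n : ℕ} {d : Fin n → S} {s : S} (f : Sg.Fn d s)
      (ts us : ∀ i, Term Sg (Vars E Y) (d i)) (C : Fin n → Constraint Sg Y) :
      ¬ (Term.app f ts).EFree → ¬ (Term.app f us).EFree → (∀ i, EProc (ts i) (us i) (C i)) →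
      EProc (.app f ts) (.app f us) (Finset.univ.biUnion C)

/-! ### The Constrained Superposition Calculus -/

/-- The states of the algorithm: finite sets of constrained literals. -/
abbrev State (Sg : Signature S) (E Y : S → Type) : Type u := Finset (CLit Sg (Vars E Y) Y)

open Classical in
/-- `Infer gt A K`: the constrained literal `K` is the conclusion of one of the three inference rules,
with premises from `A` none of which is `e`-free. -/
inductive Infer (gt : TermRel Sg E Y) (A : State Sg E Y) : CLit Sg (Vars E Y) Y → Prop
  | superpositionRight {σ τ : S} (l r u : Term Sg (Vars E Y) σ) (s t s' : Term Sg (Vars E Y) τ)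
      (C D G : Constraint Sg Y) :
      (⟨.eq s(l, r), C⟩ : CLit Sg (Vars E Y) Y) ∈ A → ⟨.eq s(s, t), D⟩ ∈ A →
      ¬ (Lit.eq s(l, r)).EFree → ¬ (Lit.eq s(s, t)).EFree →
      gt σ l r → gt τ s t → Repl u r s s' → EProc u l G →
      Infer gt A ⟨.eq s(s', t), C ∪ D ∪ G⟩
  | superpositionLeft {σ τ : S} (l r u : Term Sg (Vars E Y) σ) (s t s' : Term Sg (Vars E Y) τ)
      (C D G : Constraint Sg Y) :
      (⟨.eq s(l, r), C⟩ : CLit Sg (Vars E Y) Y) ∈ A → ⟨.ne s(s, t), D⟩ ∈ A →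
      ¬ (Lit.eq s(l, r)).EFree → ¬ (Lit.ne s(s, t)).EFree →
      gt σ l r → gt τ s t → Repl u r s s' → EProc u l G →
      Infer gt A ⟨.ne s(s', t), C ∪ D ∪ G⟩
  | reflexion {σ : S} (t u : Term Sg (Vars E Y) σ) (C G : Constraint Sg Y) :
      (⟨.ne s(t, u), C⟩ : CLit Sg (Vars E Y) Y) ∈ A → ¬ (Lit.ne s(t, u)).EFree → EProc t u G →
      Infer gt A ⟨.bot, C ∪ G⟩

/-- Constrained literals `eⱼ = t(y) ‖ D`. -/
def defn {s : S} (e : E s) (t : Term Sg Y s) (D : Constraint Sg Y) : CLit Sg (Vars E Y) Y :=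
  ⟨.eq s(evar e, t.ofPar), D⟩

def CLit.IsDefn (K : CLit Sg (Vars E Y) Y) : Prop :=
  ∃ (s : S) (e : E s) (t : Term Sg Y s) (D : Constraint Sg Y), K = defn e t D

/-- `Simplifies gt A K K'`: one application of Demodulation turns the first premise `K` into `K'`, the
second premise being a constrained literal `eⱼ = t(y) ‖ D` from `A`. If the first premise is of the form
`eⱼ = t₁(y) ‖ D` with the same `eⱼ` and the same `D`, then `t` has to be the smaller one of the two terms
(in particular, a constrained literal does not simplify itself). -/
def Simplifies (gt : TermRel Sg E Y) (A : State Sg E Y) (K K' : CLit Sg (Vars E Y) Y) : Prop :=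
  ∃ (s : S) (e : E s) (t : Term Sg Y s) (D : Constraint Sg Y), defn e t D ∈ A ∧
    gt s (evar e) t.ofPar ∧ D ⊆ K.con ∧ LitRepl (evar e) t.ofPar K.lit K'.lit ∧ K'.con = K.con ∧
    ∀ t₁ : Term Sg Y s, K = defn e t₁ D → gt s t₁.ofPar t.ofPar

/-- The constrained literal can be simplified by Demodulation, with second premise from `A`. -/
def Simplifiable (gt : TermRel Sg E Y) (A : State Sg E Y) (K : CLit Sg (Vars E Y) Y) : Prop :=
  ∃ K', Simplifies gt A K K'

open Classical in
/-- One step of the algorithm. A Demodulation adds its conclusion and removes its first premise;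
Demodulations of literals of the form `eⱼ = t₁(y) ‖ C` (by another `eⱼ = t(y) ‖ D`) have priority over
the other ones. An inference rule adds its conclusion, and is applied only if no Demodulation can be
applied. -/
inductive Step (gt : TermRel Sg E Y) (A : State Sg E Y) : State Sg E Y → Prop
  | demodulation (K K' : CLit Sg (Vars E Y) Y) : K ∈ A → Simplifies gt A K K' →
      (K.IsDefn ∨ ∀ K₁ ∈ A, K₁.IsDefn → ¬ Simplifiable gt A K₁) →
      Step gt A (insert K' (A.erase K))
  | inference (K : CLit Sg (Vars E Y) Y) : (∀ K₁ ∈ A, ¬ Simplifiable gt A K₁) → Infer gt A K →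
      Step gt A (insert K A)

/-- Saturated sets: every constrained literal that is produced by an inference rule is, after having been
exhaustively simplified by Demodulation, already in the set. -/
def Saturated (gt : TermRel Sg E Y) (A : State Sg E Y) : Prop :=
  ∀ K, Infer gt A K →
    ∃ K', Relation.ReflTransGen (Simplifies gt A) K K' ∧ ¬ Simplifiable gt A K' ∧ K' ∈ A

/-- The matrix `φ(e, y)`: the conjunction of the given literals. -/
noncomputable def matrix (Φ : List (Lit Sg (Vars E Y))) : QF Sg (Vars E Y) :=
  .conj (Φ.map Lit.toQF)

open Classical in
/-- The initial state: all `L ‖ ∅` with `L` a literal of the matrix. -/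
noncomputable def initial (Φ : List (Lit Sg (Vars E Y))) : State Sg E Y :=
  (Φ.map fun L => (⟨L, ∅⟩ : CLit Sg (Vars E Y) Y)).toFinset

/-- The conjunction of the clauses `⋀ C → L`, for all the `e`-free constrained literals `L ‖ C` of `A`. -/
noncomputable def outputFormula (A : State Sg E Y) : QF Sg Y :=
  .conj ((A.preimage CLit.ofPar CLit.ofPar_injective.injOn).toList.map CLit.clause)

/-- Some run of the algorithm, with the matrix given by `Φ` as input, reaches a saturated set and
outputs `ψ`. -/
def Outputs (gt : TermRel Sg E Y) (Φ : List (Lit Sg (Vars E Y))) (ψ : QF Sg Y) : Prop :=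
  ∃ A : State Sg E Y, Relation.ReflTransGen (Step gt) (initial Φ) A ∧ Saturated gt A ∧
    ψ = outputFormula A

end Calculus

end CSC

/-!
Soundness. Every inference is valid, and Demodulation replaces its first premise by an equivalent
literal (`Step.models_iff`), so a state reached by the algorithm is equivalent to the input
matrix. Hence the output, a part of the final state `A`, follows from the matrix.

Completeness. As residues are quantifier-free, it is enough to extend every structure `M` in which
the output is true under an assignment `J` to a structure in which the matrix, equivalently `A`,
is true for some values of the variables `e`. Constraints are evaluated in `M`; only the
constrained literals `L ‖ C` of `A` with true `C` matter. By flatness and the orientation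
conditions, their equalities are, up to `e`-free ones, rewrite rules `eⱼ → a` and `f(u₁, …, uₙ) →
a` in which `a` and the `uᵢ` are `e`-free or variables from `e`.

The extension needs no elements besides `M` and the variables `e` (`extension`). The `value` of a
variable is found by rewriting it with the rules `eⱼ → a`, chosen arbitrarily, until a variable
without rules or an `e`-free term, that is, an element of `M`, is reached. The operation `f` is
that of `M` on `M`; elsewhere it is prescribed by the rules `f(u₁, …, uₙ) → a` with irreducible
`uᵢ`, again chosen arbitrarily. Each (dis)equality of `A` with a true constraint then holds in the
extension, by induction on its larger side:

* two rules for one variable are superposed at the root, which gives a smaller equality of `A`, so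
  that the chosen one does not matter (`value_eq_of_reduces`);
* two rules for `f` with irreducible arguments of equal values are superposed at the root: the
  procedure `E` succeeds on their left-hand sides, with a true constraint (`exists_eProc`); a rule
  for `f` with a reducible argument is superposed at this argument (`eval_eq_of_reduces`);
* a disequality with reducible larger side is superposed with a rule for that side; one with an
  irreducible larger side holds because values are not larger than the variables they are values
  of; one with identical sides gives `⊥` by Reflexion, which contradicts the output formula
  (`eval_ne_of_mem`).

Saturation provides the conclusions of these inferences only up to Demodulation. This suffices
because Demodulation makes terms smaller and rewrites with the rules `eⱼ → a`, which hold in the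
extension (`exists_mem_of_infer`). The first item is proved before this is known for all
variables; there, Demodulation applies to terms that are `e`-free or smaller variables, so the
induction hypothesis is enough.
-/

/-! ### Evaluation of terms and formulae -/

namespace CSC

section Semantics

variable {S : Type u} {Sg : Signature S}

theorem Term.eval_map {X X' : S → Type w} (ρ : ∀ s, X s → X' s) (M : Struc Sg)
    (I : ∀ s, X' s → M.Carrier s) {s : S} (t : Term Sg X s) :
    (t.map ρ).eval M I = t.eval M fun s x => I s (ρ s x) := by
  induction t with
  | var x => rfl
  | app f ts ih => exact congrArg (M.fn f) (funext ih)

/-- Embeddings of structures: injective maps that commute with the operations. -/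
structure Struc.Embedding (M N : Struc Sg) where
  toFun : ∀ s, M.Carrier s → N.Carrier s
  injective : ∀ s, Function.Injective (toFun s)
  map_fn : ∀ {n : ℕ} {d : Fin n → S} {s : S} (f : Sg.Fn d s) (v : ∀ i, M.Carrier (d i)),
    toFun s (M.fn f v) = N.fn f fun i => toFun (d i) (v i)

theorem Struc.Embedding.eval {M N : Struc Sg} (h : M.Embedding N) {X : S → Type w}
    (I : ∀ s, X s → M.Carrier s) {s : S} (t : Term Sg X s) :
    t.eval N (fun s x => h.toFun s (I s x)) = h.toFun s (t.eval M I) := by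
  induction t with
  | var x => rfl
  | app f ts ih => exact (congrArg (N.fn f) (funext ih)).trans (h.map_fn f _).symm

theorem Struc.Embedding.holds_iff {M N : Struc Sg} (h : M.Embedding N) {X : S → Type w}
    (I : ∀ s, X s → M.Carrier s) (φ : QF Sg X) :
    φ.Holds N (fun s x => h.toFun s (I s x)) ↔ φ.Holds M I := by
  induction φ with
  | eq t t' => simp only [QF.Holds, h.eval, (h.injective _).eq_iff]
  | bot => rfl
  | and φ χ ih₁ ih₂ => simp only [QF.Holds, ih₁, ih₂]
  | imp φ χ ih₁ ih₂ => simp only [QF.Holds, ih₁, ih₂]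

theorem QF.conj_holds {X : S → Type w} (M : Struc Sg) (I : ∀ s, X s → M.Carrier s)
    (l : List (QF Sg X)) : (conj l).Holds M I ↔ ∀ φ ∈ l, φ.Holds M I := by
  induction l with
  | nil => simp [conj, top, Holds]
  | cons φ l ih => simp [conj, Holds, ih]

@[simp]
theorem eqFormula_holds {X : S → Type w} (M : Struc Sg) (I : ∀ s, X s → M.Carrier s) {s : S}
    (a b : Term Sg X s) : (eqFormula s(a, b)).Holds M I ↔ a.eval M I = b.eval M I := by
  have h : s((Quot.out s(a, b)).1, (Quot.out s(a, b)).2) = s(a, b) := Quot.out_eq _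
  rcases Sym2.eq_iff.1 h with ⟨h₁, h₂⟩ | ⟨h₁, h₂⟩
  · simp only [eqFormula, QF.Holds, h₁, h₂]
  · simp only [eqFormula, QF.Holds, h₁, h₂, eq_comm]

@[simp]
theorem Lit.toQF_eq_holds {X : S → Type w} (M : Struc Sg) (I : ∀ s, X s → M.Carrier s) {s : S}
    (a b : Term Sg X s) : (Lit.eq s(a, b)).toQF.Holds M I ↔ a.eval M I = b.eval M I :=
  eqFormula_holds M I a b

@[simp]
theorem Lit.toQF_ne_holds {X : S → Type w} (M : Struc Sg) (I : ∀ s, X s → M.Carrier s) {s : S}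
    (a b : Term Sg X s) : (Lit.ne s(a, b)).toQF.Holds M I ↔ a.eval M I ≠ b.eval M I :=
  not_congr (eqFormula_holds M I a b)

variable {E Y : S → Type}

/-- All the equalities of the constraint are true. -/
def ConHolds (M : Struc Sg) (J : ∀ s, Y s → M.Carrier s) (C : Constraint Sg Y) : Prop :=
  ∀ p ∈ C, (eqFormula p.2).Holds M J

theorem ConHolds.mono {M : Struc Sg} {J : ∀ s, Y s → M.Carrier s} {C D : Constraint Sg Y}
    (hC : ConHolds M J C) (h : D ⊆ C) : ConHolds M J D :=
  fun p hp => hC p (h hp)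

theorem conHolds_empty (M : Struc Sg) (J : ∀ s, Y s → M.Carrier s) : ConHolds M J ∅ :=
  fun p hp => by simp at hp

open Classical in
theorem conHolds_union {M : Struc Sg} {J : ∀ s, Y s → M.Carrier s} {C D : Constraint Sg Y} :
    ConHolds M J (C ∪ D) ↔ ConHolds M J C ∧ ConHolds M J D := by
  simp only [ConHolds, Finset.mem_union, or_imp, forall_and]

open Classical in
theorem conHolds_biUnion {M : Struc Sg} {J : ∀ s, Y s → M.Carrier s} {n : ℕ}
    {C : Fin n → Constraint Sg Y} :
    ConHolds M J (Finset.univ.biUnion C) ↔ ∀ i, ConHolds M J (C i) := by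
  simp only [ConHolds, Finset.mem_biUnion, Finset.mem_univ, true_and, forall_exists_index]
  exact forall_comm

theorem Struc.Embedding.conHolds_iff {M N : Struc Sg} (h : M.Embedding N)
    (J : ∀ s, Y s → M.Carrier s) (C : Constraint Sg Y) :
    ConHolds N (fun s y => h.toFun s (J s y)) C ↔ ConHolds M J C :=
  forall₂_congr fun _ _ => h.holds_iff J _

theorem CLit.clause_holds (M : Struc Sg) (J : ∀ s, Y s → M.Carrier s) (K : CLit Sg Y Y) :
    K.clause.Holds M J ↔ (ConHolds M J K.con → K.lit.toQF.Holds M J) := by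
  simp only [clause, QF.Holds, QF.conj_holds, List.forall_mem_map, Finset.mem_toList, ConHolds]

/-- The clause `⋀ C → L` expressed by a constrained literal is true. -/
def CLit.Sat (M : Struc Sg) (I : ∀ s, E s → M.Carrier s) (J : ∀ s, Y s → M.Carrier s)
    (K : CLit Sg (Vars E Y) Y) : Prop :=
  ConHolds M J K.con → K.lit.toQF.Holds M (joint I J)

/-- All the clauses expressed by the constrained literals of the state are true. -/
def Models (M : Struc Sg) (I : ∀ s, E s → M.Carrier s) (J : ∀ s, Y s → M.Carrier s)
    (A : State Sg E Y) : Prop :=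
  ∀ K ∈ A, K.Sat M I J

@[simp]
theorem Term.eval_ofPar (M : Struc Sg) (I : ∀ s, E s → M.Carrier s)
    (J : ∀ s, Y s → M.Carrier s) {s : S} (t : Term Sg Y s) :
    (t.ofPar : Term Sg (Vars E Y) s).eval M (joint I J) = t.eval M J :=
  t.eval_map _ M _

theorem Lit.ofPar_holds (M : Struc Sg) (I : ∀ s, E s → M.Carrier s)
    (J : ∀ s, Y s → M.Carrier s) (L : Lit Sg Y) :
    (L.ofPar : Lit Sg (Vars E Y)).toQF.Holds M (joint I J) ↔ L.toQF.Holds M J := by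
  cases L with
  | bot => rfl
  | eq p =>
    induction p with | _ a b =>
    rw [toQF_eq_holds, ← a.eval_ofPar M I J, ← b.eval_ofPar M I J]
    exact toQF_eq_holds ..
  | ne p =>
    induction p with | _ a b =>
    rw [toQF_ne_holds, ← a.eval_ofPar M I J, ← b.eval_ofPar M I J]
    exact toQF_ne_holds ..

theorem outputFormula_holds (M : Struc Sg) (J : ∀ s, Y s → M.Carrier s) (A : State Sg E Y) :
    (outputFormula A).Holds M J ↔
      ∀ K : CLit Sg Y Y, K.ofPar ∈ A → ConHolds M J K.con → K.lit.toQF.Holds M J := by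
  simp only [outputFormula, QF.conj_holds, List.forall_mem_map, Finset.mem_toList,
    Finset.mem_preimage, CLit.clause_holds]

theorem matrix_holds (M : Struc Sg) (I : ∀ s, E s → M.Carrier s) (J : ∀ s, Y s → M.Carrier s)
    (Φ : List (Lit Sg (Vars E Y))) :
    (matrix Φ).Holds M (joint I J) ↔ Models M I J (initial Φ) := by
  simp only [matrix, QF.conj_holds, List.forall_mem_map, Models, initial, List.mem_toFinset,
    CLit.Sat, conHolds_empty, true_imp_iff]

end Semantics

/-! ### Soundness of the calculus -/

section Soundness

variable {S : Type u} {Sg : Signature S} {E Y : S → Type} {gt : TermRel Sg E Y}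

theorem Repl.eval_eq {σ τ : S} {u v : Term Sg (Vars E Y) σ} {s s' : Term Sg (Vars E Y) τ}
    (h : Repl u v s s') {M : Struc Sg} {I : ∀ s, Vars E Y s → M.Carrier s}
    (huv : u.eval M I = v.eval M I) : s.eval M I = s'.eval M I := by
  induction h with
  | root => exact huv
  | arg f ts i t' _ ih =>
    refine congrArg (M.fn f) (funext fun j => ?_)
    by_cases hj : j = i
    · subst hj
      rw [Function.update_self, ih]
    · rw [Function.update_of_ne hj]

theorem LitRepl.holds_iff {σ : S} {u v : Term Sg (Vars E Y) σ} {L L' : Lit Sg (Vars E Y)}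
    (h : LitRepl u v L L') {M : Struc Sg} {I : ∀ s, Vars E Y s → M.Carrier s}
    (huv : u.eval M I = v.eval M I) : L.toQF.Holds M I ↔ L'.toQF.Holds M I := by
  cases h with
  | eq t h => rw [Lit.toQF_eq_holds, Lit.toQF_eq_holds, h.eval_eq huv]
  | ne t h => rw [Lit.toQF_ne_holds, Lit.toQF_ne_holds, h.eval_eq huv]

theorem EProc.eval_eq {s : S} {t u : Term Sg (Vars E Y) s} {C : Constraint Sg Y}
    (h : EProc t u C) {M : Struc Sg} (I : ∀ s, E s → M.Carrier s)
    {J : ∀ s, Y s → M.Carrier s} (hC : ConHolds M J C) :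
    t.eval M (joint I J) = u.eval M (joint I J) := by
  induction h with
  | same t => rfl
  | free t u _ => simpa using hC _ (Finset.mem_singleton_self _)
  | app f ts us C _ _ _ ih =>
    exact congrArg (M.fn f) (funext fun i => ih i (conHolds_biUnion.1 hC i))

theorem Infer.sat {A : State Sg E Y} {K : CLit Sg (Vars E Y) Y} (h : Infer gt A K)
    {M : Struc Sg} {I : ∀ s, E s → M.Carrier s} {J : ∀ s, Y s → M.Carrier s}
    (hA : Models M I J A) : K.Sat M I J := by
  cases h with
  | superpositionRight l r u s t s' C D G hl hs _ _ _ _ hrepl hE =>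
    intro hC
    obtain ⟨hC, hG⟩ := conHolds_union.1 hC
    obtain ⟨hC, hD⟩ := conHolds_union.1 hC
    have hur := (hE.eval_eq I hG).trans ((Lit.toQF_eq_holds ..).1 (hA _ hl hC))
    exact ((LitRepl.eq t hrepl).holds_iff hur).1 (hA _ hs hD)
  | superpositionLeft l r u s t s' C D G hl hs _ _ _ _ hrepl hE =>
    intro hC
    obtain ⟨hC, hG⟩ := conHolds_union.1 hC
    obtain ⟨hC, hD⟩ := conHolds_union.1 hC
    have hur := (hE.eval_eq I hG).trans ((Lit.toQF_eq_holds ..).1 (hA _ hl hC))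
    exact ((LitRepl.ne t hrepl).holds_iff hur).1 (hA _ hs hD)
  | reflexion t u C G ht _ hE =>
    intro hC
    obtain ⟨hC, hG⟩ := conHolds_union.1 hC
    exact (Lit.toQF_ne_holds ..).1 (hA _ ht hC) (hE.eval_eq I hG)

/-- A state and its successor are equivalent. For Demodulation this needs that the second premise
survives the removal of the first one. -/
theorem Step.models_iff (hgt : IsReductionOrdering gt) {A B : State Sg E Y} (h : Step gt A B)
    (M : Struc Sg) (I : ∀ s, E s → M.Carrier s) (J : ∀ s, Y s → M.Carrier s) :
    Models M I J A ↔ Models M I J B := by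
  classical
  cases h with
  | inference K _ hK =>
    refine ⟨fun hA K₁ hK₁ => ?_, fun hB K₁ hK₁ => hB _ (Finset.mem_insert_of_mem hK₁)⟩
    rcases Finset.mem_insert.1 hK₁ with rfl | hK₁
    exacts [hK.sat hA, hA _ hK₁]
  | demodulation K K' hK hS _ =>
    obtain ⟨s, e, t, D, hd, -, hDK, hrepl, hcon, hself⟩ := hS
    have hne : defn e t D ≠ K := fun h => hgt.irrefl _ _ (hself t h.symm)
    have key : (defn e t D).Sat M I J → (K.Sat M I J ↔ K'.Sat M I J) := by
      intro hdef
      unfold CLit.Sat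
      rw [hcon]
      exact imp_congr_right fun hC =>
        hrepl.holds_iff ((Lit.toQF_eq_holds ..).1 (hdef (hC.mono hDK)))
    constructor
    · intro hA K₁ hK₁
      rcases Finset.mem_insert.1 hK₁ with rfl | hK₁
      exacts [(key (hA _ hd)).1 (hA _ hK), hA _ (Finset.mem_of_mem_erase hK₁)]
    · intro hB K₁ hK₁
      by_cases h₁ : K₁ = K
      · subst h₁
        exact (key (hB _ (Finset.mem_insert_of_mem (Finset.mem_erase.2 ⟨hne, hd⟩)))).2
          (hB _ (Finset.mem_insert_self ..))
      · exact hB _ (Finset.mem_insert_of_mem (Finset.mem_erase.2 ⟨h₁, hK₁⟩))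

theorem models_iff_of_steps (hgt : IsReductionOrdering gt) {A B : State Sg E Y}
    (h : Relation.ReflTransGen (Step gt) A B) (M : Struc Sg) (I : ∀ s, E s → M.Carrier s)
    (J : ∀ s, Y s → M.Carrier s) : Models M I J A ↔ Models M I J B := by
  induction h with
  | refl => rfl
  | tail _ h ih => exact ih.trans (h.models_iff hgt M I J)

end Soundness

/-! ### Flatness -/

section Flatness

variable {S : Type u} {Sg : Signature S} {E Y : S → Type} {gt : TermRel Sg E Y}

theorem evar_injective {s : S} :
    Function.Injective (evar : E s → Term Sg (Vars E Y) s) :=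
  fun e e' h => by simpa [evar] using h

theorem Term.not_eFree_evar {s : S} (e : E s) : ¬ (evar e : Term Sg (Vars E Y) s).EFree := by
  rintro ⟨t, ht⟩
  cases t <;> simp [evar, Term.ofPar, Term.map] at ht

theorem Term.eFree_ofPar {s : S} (t : Term Sg Y s) : (t.ofPar : Term Sg (Vars E Y) s).EFree :=
  ⟨t, rfl⟩

theorem Term.eFree_app {n : ℕ} {d : Fin n → S} {s : S} (f : Sg.Fn d s)
    (ts : ∀ i, Term Sg (Vars E Y) (d i)) : (Term.app f ts).EFree ↔ ∀ i, (ts i).EFree := by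
  constructor
  · rintro ⟨t, ht⟩ i
    cases t with
    | var x => simp [Term.ofPar, Term.map] at ht
    | app f' ts' =>
      simp only [Term.ofPar, Term.map, Term.app.injEq] at ht
      obtain ⟨rfl, ht⟩ := ht
      obtain ⟨rfl, -, ht⟩ := ht
      exact ⟨ts' i, congrFun (eq_of_heq ht) i⟩
  · intro h
    choose ts' hts using h
    exact ⟨.app f ts', congrArg (Term.app f) (funext hts)⟩

theorem Lit.eFree_eq {s : S} (a b : Term Sg (Vars E Y) s) :
    (Lit.eq s(a, b)).EFree ↔ a.EFree ∧ b.EFree := by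
  constructor
  · rintro ⟨L, hL⟩
    cases L with
    | eq p =>
      induction p with | _ a' b' =>
      simp only [ofPar, map, Lit.eq.injEq] at hL
      obtain ⟨rfl, hL⟩ := hL
      rcases Sym2.eq_iff.1 (eq_of_heq hL) with ⟨h₁, h₂⟩ | ⟨h₁, h₂⟩
      exacts [⟨⟨_, h₁⟩, ⟨_, h₂⟩⟩, ⟨⟨_, h₁⟩, ⟨_, h₂⟩⟩]
    | ne p => simp [ofPar, map] at hL
    | bot => simp [ofPar, map] at hL
  · rintro ⟨⟨a', rfl⟩, b', rfl⟩
    exact ⟨.eq s(a', b'), rfl⟩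

theorem Lit.eFree_ne {s : S} (a b : Term Sg (Vars E Y) s) :
    (Lit.ne s(a, b)).EFree ↔ a.EFree ∧ b.EFree := by
  constructor
  · rintro ⟨L, hL⟩
    cases L with
    | ne p =>
      induction p with | _ a' b' =>
      simp only [ofPar, map, Lit.ne.injEq] at hL
      obtain ⟨rfl, hL⟩ := hL
      rcases Sym2.eq_iff.1 (eq_of_heq hL) with ⟨h₁, h₂⟩ | ⟨h₁, h₂⟩
      exacts [⟨⟨_, h₁⟩, ⟨_, h₂⟩⟩, ⟨⟨_, h₁⟩, ⟨_, h₂⟩⟩]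
    | eq p => simp [ofPar, map] at hL
    | bot => simp [ofPar, map] at hL
  · rintro ⟨⟨a', rfl⟩, b', rfl⟩
    exact ⟨.ne s(a', b'), rfl⟩

theorem Lit.eFlat_eq {s : S} {a b : Term Sg (Vars E Y) s} :
    (Lit.eq s(a, b)).EFlat ↔ a.EFlat ∧ b.IsSimple ∨ b.EFlat ∧ a.IsSimple := by
  constructor
  · intro h
    generalize hL : Lit.eq s(a, b) = L at h
    cases h with
    | eq t a' ht ha =>
      simp only [Lit.eq.injEq] at hL
      obtain ⟨rfl, hL⟩ := hL
      rcases Sym2.eq_iff.1 (eq_of_heq hL) with ⟨rfl, rfl⟩ | ⟨rfl, rfl⟩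
      exacts [.inl ⟨ht, ha⟩, .inr ⟨ht, ha⟩]
    | ne a b => simp at hL
  · rintro (⟨h₁, h₂⟩ | ⟨h₁, h₂⟩)
    · exact .eq _ _ h₁ h₂
    · rw [Sym2.eq_swap]
      exact .eq _ _ h₁ h₂

theorem Lit.eFlat_ne {s : S} {a b : Term Sg (Vars E Y) s} :
    (Lit.ne s(a, b)).EFlat ↔ a.IsSimple ∧ b.IsSimple := by
  constructor
  · intro h
    generalize hL : Lit.ne s(a, b) = L at h
    cases h with
    | ne t a' ht ha =>
      simp only [Lit.ne.injEq] at hL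
      obtain ⟨rfl, hL⟩ := hL
      rcases Sym2.eq_iff.1 (eq_of_heq hL) with ⟨rfl, rfl⟩ | ⟨rfl, rfl⟩
      exacts [⟨ht, ha⟩, ⟨ha, ht⟩]
    | eq a b => simp at hL
  · rintro ⟨h₁, h₂⟩
    exact .ne _ _ h₁ h₂

theorem Repl.eFree {σ τ : S} {u v : Term Sg (Vars E Y) σ} {s s' : Term Sg (Vars E Y) τ}
    (h : Repl u v s s') (hs : s.EFree) : u.EFree := by
  induction h with
  | root => exact hs
  | arg f ts i t' _ ih => exact ih ((Term.eFree_app f ts).1 hs i)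

theorem Repl.isSimple {σ τ : S} {u v : Term Sg (Vars E Y) σ} {s s' : Term Sg (Vars E Y) τ}
    (h : Repl u v s s') (hu : ¬ u.EFree) (hv : v.IsSimple) (hs : s.IsSimple) : s'.IsSimple := by
  rcases hs with hs | ⟨e, rfl⟩
  · exact absurd (h.eFree hs) hu
  · generalize ht : evar e = t at h
    cases h with
    | root => exact hv
    | arg f ts i t' _ => simp [evar] at ht

theorem Repl.eFlat {σ τ : S} {u v : Term Sg (Vars E Y) σ} {s s' : Term Sg (Vars E Y) τ}
    (h : Repl u v s s') (hu : ¬ u.EFree) (hv : v.IsSimple) (hs : s.EFlat) : s'.EFlat := by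
  cases hs with
  | simple hs => exact .simple (h.isSimple hu hv hs)
  | app f us hus =>
    generalize ht : Term.app f us = t at h
    cases h with
    | root => exact .simple hv
    | arg f' ts i t' h =>
      simp only [Term.app.injEq] at ht
      obtain ⟨rfl, ht⟩ := ht
      obtain ⟨rfl, hf, ht⟩ := ht
      obtain rfl := eq_of_heq hf
      obtain rfl := eq_of_heq ht
      refine .app f _ fun j => ?_
      by_cases hj : j = i
      · subst hj
        rw [Function.update_self]
        exact h.isSimple hu hv (hus _)
      · rw [Function.update_of_ne hj]
        exact hus j

theorem LitRepl.eFlat {σ : S} {u v : Term Sg (Vars E Y) σ} {L L' : Lit Sg (Vars E Y)}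
    (h : LitRepl u v L L') (hu : ¬ u.EFree) (hv : v.IsSimple) (hL : L.EFlat) : L'.EFlat := by
  cases h with
  | eq t h =>
    rw [Lit.eFlat_eq] at hL ⊢
    exact hL.imp (And.imp_left (h.eFlat hu hv)) (And.imp_right (h.isSimple hu hv))
  | ne t h =>
    rw [Lit.eFlat_ne] at hL ⊢
    exact hL.imp_left (h.isSimple hu hv)

theorem EProc.eFree_right {s : S} {t u : Term Sg (Vars E Y) s} {C : Constraint Sg Y}
    (h : EProc t u C) (ht : t.EFree) : u.EFree := by
  cases h with
  | same => exact ht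
  | free t u _ => exact u.eFree_ofPar
  | app f ts us C h₁ _ _ => exact absurd ht h₁

/-- In an equality that is not `e`-free the larger side is not `e`-free, and the smaller one is
`e`-free or a variable from `e`. -/
theorem OrientsFlat.eq_sides (hgt : IsReductionOrdering gt) (hflat : OrientsFlat gt) {s : S}
    {l r : Term Sg (Vars E Y) s} (h : (Lit.eq s(l, r)).EFlat) (hfree : ¬ (Lit.eq s(l, r)).EFree)
    (hlr : gt s l r) : ¬ l.EFree ∧ l.EFlat ∧ r.IsSimple := by
  have asymm : ¬ gt s r l := fun h => hgt.irrefl _ _ (hgt.trans _ _ _ _ h hlr)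
  rw [Lit.eFree_eq] at hfree
  rcases Lit.eFlat_eq.1 h with ⟨hl, hr⟩ | ⟨hr, hl⟩
  · refine ⟨fun hl' => asymm ?_, hl, hr⟩
    exact hflat.toFree _ _ _ (.simple hr) (fun hr' => hfree ⟨hl', hr'⟩) hl'
  · have hlf : ¬ l.EFree := fun hl' =>
      asymm (hflat.toFree _ _ _ hr (fun hr' => hfree ⟨hl', hr'⟩) hl')
    refine ⟨hlf, .simple hl, ?_⟩
    by_contra hrs
    exact asymm (hflat.toEVar _ _ _ hr (fun h => hrs (.inl h)) (fun h => hrs (.inr h))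
      (hl.resolve_left hlf))

/-- All literals of the state are `e`-flat or `⊥`. -/
def FlatState (A : State Sg E Y) : Prop := ∀ K ∈ A, K.lit = .bot ∨ K.lit.EFlat

theorem Infer.eFlat (hgt : IsReductionOrdering gt) (hflat : OrientsFlat gt) {A : State Sg E Y}
    (hA : FlatState A) {K : CLit Sg (Vars E Y) Y} (h : Infer gt A K) :
    K.lit = .bot ∨ K.lit.EFlat := by
  cases h with
  | superpositionRight l r u s t s' C D G hl hs hl' _ hlr _ hrepl hE =>
    obtain ⟨h₁, -, h₂⟩ := hflat.eq_sides hgt ((hA _ hl).resolve_left (by simp)) hl' hlr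
    exact .inr ((LitRepl.eq t hrepl).eFlat (fun h => h₁ (hE.eFree_right h)) h₂
      ((hA _ hs).resolve_left (by simp)))
  | superpositionLeft l r u s t s' C D G hl hs hl' _ hlr _ hrepl hE =>
    obtain ⟨h₁, -, h₂⟩ := hflat.eq_sides hgt ((hA _ hl).resolve_left (by simp)) hl' hlr
    exact .inr ((LitRepl.ne t hrepl).eFlat (fun h => h₁ (hE.eFree_right h)) h₂
      ((hA _ hs).resolve_left (by simp)))
  | reflexion => exact .inl rfl

theorem Step.flatState (hgt : IsReductionOrdering gt) (hflat : OrientsFlat gt)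
    {A B : State Sg E Y} (hA : FlatState A) (h : Step gt A B) : FlatState B := by
  classical
  cases h with
  | inference K _ hK =>
    intro K₁ hK₁
    rcases Finset.mem_insert.1 hK₁ with rfl | hK₁
    exacts [hK.eFlat hgt hflat hA, hA _ hK₁]
  | demodulation K K' hK hS _ =>
    obtain ⟨s, e, t, D, -, -, -, hrepl, -⟩ := hS
    intro K₁ hK₁
    rcases Finset.mem_insert.1 hK₁ with rfl | hK₁
    · have hb : K.lit ≠ .bot := fun hb => by
        rw [hb] at hrepl
        cases hrepl
      exact .inr (hrepl.eFlat (Term.not_eFree_evar e) (.inl t.eFree_ofPar)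
        ((hA _ hK).resolve_left hb))
    · exact hA _ (Finset.mem_of_mem_erase hK₁)

theorem flatState_of_steps (hgt : IsReductionOrdering gt) (hflat : OrientsFlat gt)
    {Φ : List (Lit Sg (Vars E Y))} (hΦ : ∀ L ∈ Φ, L.EFlat) {A : State Sg E Y}
    (h : Relation.ReflTransGen (Step gt) (initial Φ) A) : FlatState A := by
  induction h with
  | refl =>
    intro K hK
    simp only [initial, List.mem_toFinset, List.mem_map] at hK
    obtain ⟨L, hL, rfl⟩ := hK
    exact .inr (hΦ L hL)
  | tail _ h ih => exact h.flatState hgt hflat ih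

theorem Repl.decreasing (hgt : IsReductionOrdering gt) {σ τ : S} {u v : Term Sg (Vars E Y) σ}
    {s s' : Term Sg (Vars E Y) τ} (h : Repl u v s s') (huv : gt σ u v) : gt τ s s' := by
  induction h with
  | root => exact huv
  | arg f ts i t' _ ih => simpa using hgt.compat f ts i _ _ ih

end Flatness

/-! ### The extension of a structure determined by a state -/

section Extension

variable {S : Type u} {Sg : Signature S} {E Y : S → Type} {gt : TermRel Sg E Y}

/-- Some constrained literal `t = r ‖ C` of the state has a true constraint and is oriented from `t`
to `r`. -/
def Reduces (gt : TermRel Sg E Y) (A : State Sg E Y) (M : Struc Sg)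
    (J : ∀ s, Y s → M.Carrier s) {s : S} (t r : Term Sg (Vars E Y) s) : Prop :=
  ∃ C, (⟨.eq s(t, r), C⟩ : CLit Sg (Vars E Y) Y) ∈ A ∧ ConHolds M J C ∧ gt s t r

/-- `e`-free terms, and variables from `e` which the true equalities of the state do not reduce. -/
def Irreducible (gt : TermRel Sg E Y) (A : State Sg E Y) (M : Struc Sg)
    (J : ∀ s, Y s → M.Carrier s) {s : S} (t : Term Sg (Vars E Y) s) : Prop :=
  t.EFree ∨ t.IsEVar ∧ ∀ r, ¬ Reduces gt A M J t r

open Classical in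
/-- The value of an `e`-free term or of a variable from `e` in `M ⊕ E`, found by reducing it as
long as possible by arbitrarily chosen true equalities of the state. The values of other
irreducible terms are irrelevant. -/
noncomputable def value (hgt : IsReductionOrdering gt) (A : State Sg E Y) (M : Struc Sg)
    (J : ∀ s, Y s → M.Carrier s) {s : S} : Term Sg (Vars E Y) s → M.Carrier s ⊕ E s :=
  (hgt.wf s).fix fun t val =>
    if h : t.EFree then .inl (h.choose.eval M J)
    else if h : ∃ r, Reduces gt A M J t r then val h.choose h.choose_spec.choose_spec.2.2
    else if h : t.IsEVar then .inr h.choose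
    else .inl (Classical.choice (M.nonempty s))

section Value

variable (hgt : IsReductionOrdering gt) (A : State Sg E Y) (M : Struc Sg)
  (J : ∀ s, Y s → M.Carrier s)

theorem value_ofPar {s : S} (t : Term Sg Y s) : value hgt A M J t.ofPar = .inl (t.eval M J) := by
  have h : (t.ofPar : Term Sg (Vars E Y) s).EFree := t.eFree_ofPar
  rw [value, WellFounded.fix_eq, dif_pos h, ← Term.ofPar_injective h.choose_spec]

theorem value_of_reducible {s : S} {t : Term Sg (Vars E Y) s} (ht : ¬ t.EFree)
    (h : ∃ r, Reduces gt A M J t r) :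
    ∃ r, Reduces gt A M J t r ∧ value hgt A M J t = value hgt A M J r := by
  refine ⟨h.choose, h.choose_spec, ?_⟩
  conv_lhs => rw [value, WellFounded.fix_eq, dif_neg ht, dif_pos h]
  rfl

theorem value_evar {s : S} {e : E s} (h : ∀ r, ¬ Reduces gt A M J (evar e) r) :
    value hgt A M J (evar e) = .inr e := by
  have he : (evar e : Term Sg (Vars E Y) s).IsEVar := ⟨e, rfl⟩
  rw [value, WellFounded.fix_eq, dif_neg (Term.not_eFree_evar e), dif_neg (not_exists.2 h),
    dif_pos he]
  exact congrArg Sum.inr (evar_injective (Sg := Sg) (Y := Y) he.choose_spec).symm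

/-- The equality `f(us) = a`, with irreducible arguments `us` of values `v`, is one of the true
equalities of the state: it prescribes the value of `f` at `v`. -/
def Prescribes {n : ℕ} {d : Fin n → S} {s : S} (f : Sg.Fn d s)
    (v : ∀ i, M.Carrier (d i) ⊕ E (d i)) (a : Term Sg (Vars E Y) s) : Prop :=
  ∃ (us : ∀ i, Term Sg (Vars E Y) (d i)) (C : Constraint Sg Y),
    (⟨.eq s(.app f us, a), C⟩ : CLit Sg (Vars E Y) Y) ∈ A ∧ ConHolds M J C ∧
    ¬ (Term.app f us).EFree ∧ a.IsSimple ∧ (∀ i, Irreducible gt A M J (us i)) ∧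
    ∀ i, value hgt A M J (us i) = v i

open Classical in
/-- The extension of `M` by the variables from `e`. The operations are those of `M` on `M`;
elsewhere they are as prescribed by the true equalities of the state, and arbitrary if nothing is
prescribed. -/
noncomputable def extension : Struc Sg where
  Carrier s := M.Carrier s ⊕ E s
  nonempty s := (M.nonempty s).map .inl
  fn {_ _ s} f v :=
    if h : ∃ m, v = fun i => .inl (m i) then .inl (M.fn f h.choose)
    else if h : ∃ a, Prescribes hgt A M J f v a then value hgt A M J h.choose
    else .inl (Classical.choice (M.nonempty s))

/-- `M` is a substructure of its extension. -/
noncomputable def extensionEmbedding : M.Embedding (extension hgt A M J) where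
  toFun _ := .inl
  injective _ := Sum.inl_injective
  map_fn {n d s} f v := by
    have h : ∃ m : ∀ i, M.Carrier (d i),
        (fun i => .inl (v i) : ∀ i, M.Carrier (d i) ⊕ E (d i)) =
        fun i => .inl (m i) := ⟨v, rfl⟩
    have hv : h.choose = v := funext fun i => (Sum.inl_injective (congrFun h.choose_spec i)).symm
    refine Eq.trans ?_ (dif_pos h).symm
    rw [hv]

/-- The assignment in the extension: variables from `e` get their values, parameters keep theirs. -/
noncomputable abbrev extAssign : ∀ s, Vars E Y s → (extension hgt A M J).Carrier s :=
  joint (fun _ e => value hgt A M J (evar e))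
    (fun s y => (extensionEmbedding hgt A M J).toFun s (J s y))

/-- The value of a term in the extension under this assignment. -/
noncomputable abbrev evalExt {s : S} (t : Term Sg (Vars E Y) s) : M.Carrier s ⊕ E s :=
  t.eval (extension hgt A M J) (extAssign hgt A M J)

theorem eval_ofPar_extension {s : S} (t : Term Sg Y s) :
    evalExt hgt A M J (t.ofPar : Term Sg (Vars E Y) s) =
      .inl (t.eval M J) := by
  exact (Term.eval_ofPar _ _ _ t).trans ((extensionEmbedding hgt A M J).eval J t)

theorem eval_extension {s : S} {t : Term Sg (Vars E Y) s} (ht : t.IsSimple) :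
    evalExt hgt A M J t = value hgt A M J t := by
  rcases ht with ⟨t, rfl⟩ | ⟨e, rfl⟩
  · rw [eval_ofPar_extension, value_ofPar]
  · rfl

/-- The procedure `E` succeeds on irreducible terms of equal value, with a true constraint. -/
theorem exists_eProc {s : S} {t u : Term Sg (Vars E Y) s} (ht : Irreducible gt A M J t)
    (hu : Irreducible gt A M J u) (h : value hgt A M J t = value hgt A M J u) :
    ∃ C, EProc t u C ∧ ConHolds M J C := by
  rcases ht with ⟨t, rfl⟩ | ⟨⟨e, rfl⟩, ht⟩ <;> rcases hu with ⟨u, rfl⟩ | ⟨⟨e', rfl⟩, hu⟩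
  · rw [value_ofPar, value_ofPar] at h
    by_cases htu : t = u
    · subst htu
      exact ⟨∅, .same _, conHolds_empty M J⟩
    · refine ⟨_, .free t u htu, fun p hp => ?_⟩
      rw [Finset.mem_singleton.1 hp]
      exact (eqFormula_holds ..).2 (Sum.inl_injective h)
  · rw [value_ofPar, value_evar hgt A M J hu] at h
    cases h
  · rw [value_ofPar, value_evar hgt A M J ht] at h
    cases h
  · rw [value_evar hgt A M J ht, value_evar hgt A M J hu] at h
    cases h
    exact ⟨∅, .same _, conHolds_empty M J⟩

/-- The value of a variable from `e` is, if not in `M`, that variable or a smaller one. -/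
theorem eq_or_gt_of_value_eq_inr (hflat : OrientsFlat gt) (hA : FlatState A) {s : S} {e' : E s}
    {t : Term Sg (Vars E Y) s} (ht : t.IsSimple) (h : value hgt A M J t = .inr e') :
    t = evar e' ∨ gt s t (evar e') := by
  induction t using (hgt.wf s).induction with | _ t ih =>
  rcases ht with ⟨t, rfl⟩ | ⟨e, rfl⟩
  · rw [value_ofPar] at h
    cases h
  by_cases hr : ∃ r, Reduces gt A M J (evar e) r
  · obtain ⟨r, ⟨C, hC, -, her⟩, hv⟩ := value_of_reducible hgt A M J (Term.not_eFree_evar e) hr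
    have hne : ¬ (Lit.eq s(evar e, r)).EFree := fun h =>
      Term.not_eFree_evar e ((Lit.eFree_eq _ _).1 h).1
    have hrs := (hflat.eq_sides hgt ((hA _ hC).resolve_left (by simp)) hne her).2.2
    right
    rcases ih r her hrs (hv ▸ h) with rfl | h'
    exacts [her, hgt.trans _ _ _ _ her h']
  · rw [value_evar hgt A M J (not_exists.1 hr)] at h
    cases h
    exact .inl rfl

end Value

/-! ### Saturated states hold in the extension -/

section Saturation

variable (hgt : IsReductionOrdering gt) {A : State Sg E Y} {M : Struc Sg}
  {J : ∀ s, Y s → M.Carrier s}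

/-- Exhaustive simplification of (dis)equalities with a true constraint: `R` stands for any
property of terms that Demodulation preserves, and it is required that Demodulation does not change
the values in the extension of the terms with this property. -/
theorem exists_of_simplifies {s : S} {mk : Sym2 (Term Sg (Vars E Y) s) → Lit Sg (Vars E Y)}
    (hmk : mk = .eq ∨ mk = .ne) (R : Term Sg (Vars E Y) s → Prop)
    (hR : ∀ {σ : S} (e : E σ) (t : Term Sg Y σ) x x',
      Reduces gt A M J (evar e) t.ofPar → Repl (evar e) t.ofPar x x' → R x →
      R x' ∧ evalExt hgt A M J x' =
        evalExt hgt A M J x)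
    {x y : Term Sg (Vars E Y) s} {C : Constraint Sg Y} (hC : ConHolds M J C) (hx : R x) (hy : R y)
    {K' : CLit Sg (Vars E Y) Y} (h : Relation.ReflTransGen (Simplifies gt A) ⟨mk s(x, y), C⟩ K') :
    ∃ x' y', K' = ⟨mk s(x', y'), C⟩ ∧ R x' ∧ R y' ∧
      evalExt hgt A M J x' =
        evalExt hgt A M J x ∧
      evalExt hgt A M J y' =
        evalExt hgt A M J y := by
  induction h with
  | refl => exact ⟨x, y, rfl, hx, hy, rfl, rfl⟩
  | @tail K₁ K₂ _ hS ih =>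
    obtain ⟨x₁, y₁, rfl, hx₁, hy₁, hxe, hye⟩ := ih
    obtain ⟨σ, e, t, D, hd, hlt, hD, hrepl, hcon, -⟩ := hS
    have hred : Reduces gt A M J (evar e) t.ofPar := ⟨D, hd, hC.mono hD, hlt⟩
    have key : ∃ z z' w, s(x₁, y₁) = s(z, w) ∧ Repl (evar e) t.ofPar z z' ∧
        K₂.lit = mk s(z', w) := by
      obtain ⟨L, C₂⟩ := K₂
      dsimp only at hrepl ⊢
      rcases hmk with rfl | rfl
      · generalize hL : Lit.eq s(x₁, y₁) = L₁ at hrepl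
        cases hrepl with
        | eq w hz =>
          simp only [Lit.eq.injEq] at hL
          obtain ⟨rfl, hL⟩ := hL
          exact ⟨_, _, w, eq_of_heq hL, hz, rfl⟩
        | ne => simp at hL
      · generalize hL : Lit.ne s(x₁, y₁) = L₁ at hrepl
        cases hrepl with
        | ne w hz =>
          simp only [Lit.ne.injEq] at hL
          obtain ⟨rfl, hL⟩ := hL
          exact ⟨_, _, w, eq_of_heq hL, hz, rfl⟩
        | eq => simp at hL
    obtain ⟨z, z', w, hzw, hz, hlit⟩ := key
    rcases Sym2.eq_iff.1 hzw with ⟨rfl, rfl⟩ | ⟨rfl, rfl⟩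
    · obtain ⟨h₁, h₂⟩ := hR e t _ _ hred hz hx₁
      exact ⟨z', _, CLit.ext hlit hcon, h₁, hy₁, h₂.trans hxe, hye⟩
    · obtain ⟨h₁, h₂⟩ := hR e t _ _ hred hz hy₁
      exact ⟨_, z', CLit.ext (hlit.trans (congrArg mk Sym2.eq_swap)) hcon, hx₁, h₁, hxe,
        h₂.trans hye⟩

variable (hflat : OrientsFlat gt) (hA : FlatState A) (hsat : Saturated gt A)
  (hM : (outputFormula A).Holds M J)

include hM in
/-- Literals without `e` hold in the extension because they are part of the output formula. -/
theorem holds_of_eFree {L : Lit Sg (Vars E Y)} {C : Constraint Sg Y} (hL : L.EFree)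
    (hmem : ⟨L, C⟩ ∈ A) (hC : ConHolds M J C) :
    L.toQF.Holds (extension hgt A M J) (extAssign hgt A M J) := by
  obtain ⟨L, rfl⟩ := hL
  refine (Lit.ofPar_holds _ _ _ L).2 (((extensionEmbedding hgt A M J).holds_iff J _).2 ?_)
  exact (outputFormula_holds M J A).1 hM ⟨L, C⟩ hmem hC

include hM in
/-- An equality with a true constraint holds in the extension if it does so whenever it is not
`e`-free, in the direction in which it is oriented. -/
theorem eval_eq_of_mem {s : S} {x y : Term Sg (Vars E Y) s} {C : Constraint Sg Y}
    (hmem : ⟨.eq s(x, y), C⟩ ∈ A) (hC : ConHolds M J C)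
    (hx : gt s x y → ¬ (Lit.eq s(x, y)).EFree →
      evalExt hgt A M J x =
        evalExt hgt A M J y)
    (hy : gt s y x → ¬ (Lit.eq s(y, x)).EFree →
      evalExt hgt A M J y =
        evalExt hgt A M J x) :
    evalExt hgt A M J x =
      evalExt hgt A M J y := by
  by_cases hfree : (Lit.eq s(x, y)).EFree
  · exact (Lit.toQF_eq_holds ..).1 (holds_of_eFree hgt hM hfree hmem hC)
  by_cases hxy : x = y
  · rw [hxy]
  rcases hgt.total s x y hxy with h | h
  · exact hx h hfree
  · exact (hy h (by rwa [Sym2.eq_swap])).symm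

include hflat hA hsat hM in
/-- The values of the variables from `e` do not depend on the choice of the equalities by which they
are reduced: two equalities for one variable are superposed at the root. -/
theorem value_eq_of_reduces {s : S} {t r : Term Sg (Vars E Y) s} (ht : t.IsEVar)
    (h : Reduces gt A M J t r) : value hgt A M J t = value hgt A M J r := by
  classical
  induction t using (hgt.wf s).induction generalizing r with | _ t ih =>
  have htf : ¬ t.EFree := by
    obtain ⟨e, rfl⟩ := ht
    exact Term.not_eFree_evar e
  obtain ⟨r₀, ⟨C₀, hmem₀, hC₀, hlt₀⟩, hv⟩ := value_of_reducible hgt A M J htf ⟨r, h⟩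
  obtain ⟨C, hmem, hC, hlt⟩ := h
  have hfree : ∀ a, ¬ (Lit.eq s(t, a)).EFree := fun a h => htf ((Lit.eFree_eq _ _).1 h).1
  have hr₀ := (hflat.eq_sides hgt ((hA _ hmem₀).resolve_left (by simp)) (hfree _) hlt₀).2.2
  have hr := (hflat.eq_sides hgt ((hA _ hmem).resolve_left (by simp)) (hfree _) hlt).2.2
  obtain ⟨K', hK', -, hK'A⟩ := hsat _ (.superpositionRight t r₀ t t r r₀ C₀ C ∅ hmem₀ hmem
    (hfree _) (hfree _) hlt₀ hlt .root (.same t))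
  have hcon : ConHolds M J (C₀ ∪ C ∪ ∅) :=
    conHolds_union.2 ⟨conHolds_union.2 ⟨hC₀, hC⟩, conHolds_empty M J⟩
  obtain ⟨x', y', rfl, ⟨hx', hx't⟩, ⟨hy', hy't⟩, hxe, hye⟩ := exists_of_simplifies hgt (.inl rfl)
    (fun x => x.IsSimple ∧ gt s t x) (fun e a x x' hred hrepl hx => by
      obtain ⟨hx, htx⟩ := hx
      rcases hx with hx | ⟨e', rfl⟩
      · exact absurd (hrepl.eFree hx) (Term.not_eFree_evar e)
      · generalize hz : evar e' = z at hrepl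
        cases hrepl with
        | arg => simp [evar] at hz
        | root =>
          have ha : (a.ofPar : Term Sg (Vars E Y) s).IsSimple := .inl a.eFree_ofPar
          refine ⟨⟨ha, hgt.trans _ _ _ _ htx (hz ▸ hred.choose_spec.2.2)⟩, ?_⟩
          rw [eval_extension _ _ _ _ ha, ← ih _ (hz ▸ htx) ⟨_, rfl⟩ hred]
          rfl) hcon ⟨hr₀, hlt₀⟩ ⟨hr, hlt⟩ hK'
  have key := eval_eq_of_mem hgt hM hK'A hcon
    (fun hgt' hf => by
      have h₁ := (hflat.eq_sides hgt ((hA _ hK'A).resolve_left (by simp)) hf hgt').1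
      rw [eval_extension _ _ _ _ hx', eval_extension _ _ _ _ hy']
      exact ih _ hx't (hx'.resolve_left h₁) ⟨_, hK'A, hcon, hgt'⟩)
    (fun hgt' hf => by
      rw [Sym2.eq_swap] at hK'A
      have h₁ := (hflat.eq_sides hgt ((hA _ hK'A).resolve_left (by simp)) hf hgt').1
      rw [eval_extension _ _ _ _ hx', eval_extension _ _ _ _ hy']
      exact ih _ hy't (hy'.resolve_left h₁) ⟨_, hK'A, hcon, hgt'⟩)
  rw [hxe, hye, eval_extension _ _ _ _ hr₀, eval_extension _ _ _ _ hr] at key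
  exact hv.trans key

include hflat hA hsat hM in
theorem eval_eq_of_reduces_evar {s : S} {e : E s} {r : Term Sg (Vars E Y) s}
    (h : Reduces gt A M J (evar e) r) :
    evalExt hgt A M J (evar e : Term Sg (Vars E Y) s) =
      evalExt hgt A M J r := by
  have hf : ∀ a : Term Sg (Vars E Y) s, ¬ (Lit.eq s(evar e, a)).EFree := fun a h =>
    Term.not_eFree_evar e ((Lit.eFree_eq _ _).1 h).1
  have hr : r.IsSimple := by
    obtain ⟨C, hmem, -, hlt⟩ := h
    exact (hflat.eq_sides hgt ((hA _ hmem).resolve_left (by simp)) (hf _) hlt).2.2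
  rw [eval_extension _ _ _ _ hr]
  exact value_eq_of_reduces hgt hflat hA hsat hM ⟨e, rfl⟩ h

include hflat hA hsat hM in
/-- The conclusion of an inference, when it is a (dis)equality with a true constraint, is by
saturation equivalent in the extension to one from the state whose sides are below any common bound
of the sides of the conclusion. -/
theorem exists_mem_of_infer {s : S} {mk : Sym2 (Term Sg (Vars E Y) s) → Lit Sg (Vars E Y)}
    (hmk : mk = .eq ∨ mk = .ne) {t x y : Term Sg (Vars E Y) s} {C : Constraint Sg Y}
    (h : Infer gt A ⟨mk s(x, y), C⟩) (hC : ConHolds M J C) (hx : gt s t x) (hy : gt s t y) :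
    ∃ x' y', ⟨mk s(x', y'), C⟩ ∈ A ∧ gt s t x' ∧ gt s t y' ∧
      evalExt hgt A M J x' =
        evalExt hgt A M J x ∧
      evalExt hgt A M J y' =
        evalExt hgt A M J y := by
  obtain ⟨K', hK', -, hK'A⟩ := hsat _ h
  obtain ⟨x', y', rfl, h⟩ := exists_of_simplifies hgt hmk (gt s t)
    (fun e a x x' hred hrepl hx =>
      ⟨hgt.trans _ _ _ _ hx (hrepl.decreasing hgt hred.choose_spec.2.2),
        (hrepl.eval_eq (eval_eq_of_reduces_evar hgt hflat hA hsat hM hred)).symm⟩) hC hx hy hK'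
  exact ⟨x', y', hK'A, h⟩

include hflat hA hsat hM in
/-- The oriented equalities with true constraints hold in the extension; two prescriptions for the
same value of an operation are compatible because they are superposed at the root. -/
theorem eval_eq_of_reduces {s : S} {t a : Term Sg (Vars E Y) s} (h : Reduces gt A M J t a) :
    evalExt hgt A M J t =
      evalExt hgt A M J a := by
  classical
  induction t using (hgt.wf s).induction generalizing a with | _ t ih =>
  obtain ⟨C, hmem, hC, hlt⟩ := h
  by_cases hfree : (Lit.eq s(t, a)).EFree
  · exact (Lit.toQF_eq_holds ..).1 (holds_of_eFree hgt hM hfree hmem hC)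
  obtain ⟨htf, ht, ha⟩ := hflat.eq_sides hgt ((hA _ hmem).resolve_left (by simp)) hfree hlt
  have infer_eq : ∀ {x y : Term Sg (Vars E Y) s} {D : Constraint Sg Y},
      Infer gt A ⟨.eq s(x, y), D⟩ → ConHolds M J D → gt s t x → gt s t y →
      evalExt hgt A M J x =
        evalExt hgt A M J y := by
    intro x y D hI hD hx hy
    obtain ⟨x', y', hmem', hx', hy', hxe, hye⟩ :=
      exists_mem_of_infer hgt hflat hA hsat hM (.inl rfl) hI hD hx hy
    rw [← hxe, ← hye]
    refine eval_eq_of_mem hgt hM hmem' hD (fun h _ => ih _ hx' ⟨D, hmem', hD, h⟩)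
      (fun h _ => ih _ hy' ⟨D, ?_, hD, h⟩)
    rwa [Sym2.eq_swap]
  cases ht with
  | simple ht =>
    obtain ⟨e, rfl⟩ := ht.resolve_left htf
    exact eval_eq_of_reduces_evar hgt hflat hA hsat hM ⟨C, hmem, hC, hlt⟩
  | app f us hus =>
    by_cases hirr : ∀ i, Irreducible gt A M J (us i)
    · -- The value of `f` is prescribed by some equality `f(us₀) = a₀` of the state.
      have hpres : ∃ a, Prescribes hgt A M J f (fun i => value hgt A M J (us i)) a :=
        ⟨a, us, C, hmem, hC, htf, ha, hirr, fun _ => rfl⟩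
      have hnot : ¬ ∃ m : ∀ i, M.Carrier _,
          (fun i => value hgt A M J (us i)) = fun i => .inl (m i) := by
        rintro ⟨m, hm⟩
        refine htf ((Term.eFree_app f us).2 fun i => (hirr i).resolve_right ?_)
        rintro ⟨⟨e, he⟩, hir⟩
        have h : value hgt A M J (us i) = .inl (m i) := congrFun hm i
        rw [he] at h hir
        rw [value_evar hgt A M J hir] at h
        cases h
      have heval : evalExt hgt A M J (Term.app f us) =
          value hgt A M J hpres.choose := by
        have h₁ : (fun i => evalExt hgt A M J (us i)) =
            fun i => value hgt A M J (us i) := funext fun i => eval_extension _ _ _ _ (hus i)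
        refine (congrArg ((extension hgt A M J).fn f) h₁).trans ?_
        exact (dif_neg hnot).trans (dif_pos hpres)
      obtain ⟨us₀, C₀, hmem₀, hC₀, hf₀, ha₀, hirr₀, hv₀⟩ := hpres.choose_spec
      rw [heval, ← eval_extension _ _ _ _ ha₀]
      generalize hpres.choose = a₀ at hmem₀ ha₀
      choose G hG hGM using fun i => exists_eProc hgt A M J (hirr i) (hirr₀ i) (hv₀ i).symm
      have orient : ∀ {vs} {b : Term Sg (Vars E Y) s}, (∀ i, (vs i).IsSimple) →
          ¬ (Term.app f vs).EFree → b.IsSimple → gt s (.app f vs) b := by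
        intro vs b hvs hvf hb
        rcases hb with hb | hb
        · exact hflat.toFree _ _ _ (.app f vs hvs) hvf hb
        · refine hflat.toEVar _ _ _ (.app f vs hvs) hvf ?_ hb
          rintro ⟨e, he⟩
          simp [evar] at he
      exact infer_eq
        (.superpositionRight (.app f us₀) a₀ (.app f us) (.app f us) a a₀ C₀ C _ hmem₀ hmem
          (fun h => hf₀ ((Lit.eFree_eq _ _).1 h).1) hfree
          (orient (fun i => (hirr₀ i).imp_right And.left) hf₀ ha₀) hlt .root
          (.app f us us₀ G htf hf₀ hG))
        (conHolds_union.2 ⟨conHolds_union.2 ⟨hC₀, hC⟩, conHolds_biUnion.2 hGM⟩)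
        (orient hus htf ha₀) hlt
    · -- An argument is reducible: superpose at its position.
      obtain ⟨i, hi⟩ := not_forall.1 hirr
      obtain ⟨e, he⟩ := (hus i).resolve_left fun h => hi (.inl h)
      obtain ⟨r, hr⟩ : ∃ r, Reduces gt A M J (us i) r := by
        by_contra h
        exact hi (.inr ⟨⟨e, he⟩, not_exists.1 h⟩)
      have her := eval_eq_of_reduces_evar hgt hflat hA hsat hM (he ▸ hr)
      obtain ⟨D, hD, hDM, hlt'⟩ := id hr
      have hrepl : Repl (us i) r (.app f us) (.app f (Function.update us i r)) := .arg f us i r .root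
      have hf' : ¬ (Lit.eq s(us i, r)).EFree := fun h =>
        Term.not_eFree_evar e (he ▸ ((Lit.eFree_eq _ _).1 h).1)
      exact (hrepl.eval_eq (he ▸ her)).trans <| infer_eq
        (.superpositionRight (us i) r (us i) (.app f us) a _ D C ∅ hD hmem hf' hfree hlt' hlt hrepl (.same _))
        (conHolds_union.2 ⟨conHolds_union.2 ⟨hDM, hC⟩, conHolds_empty M J⟩)
        (hrepl.decreasing hgt hlt') hlt

include hgt hsat hM in
theorem not_infer_bot {C : Constraint Sg Y} (h : Infer gt A ⟨.bot, C⟩) (hC : ConHolds M J C) :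
    False := by
  obtain ⟨K', hK', -, hK'A⟩ := hsat _ h
  have hK : K' = ⟨.bot, C⟩ := by
    clear hK'A
    induction hK' with
    | refl => rfl
    | tail _ hS ih =>
      -- Demodulation does not apply to `⊥`.
      obtain ⟨_, _, _, _, -, -, -, hrepl, -⟩ := hS
      rw [ih] at hrepl
      cases hrepl
  rw [hK] at hK'A
  exact holds_of_eFree hgt hM ⟨.bot, rfl⟩ hK'A hC

include hflat hA hsat hM in
theorem eval_ne_of_mem {s : S} {t a : Term Sg (Vars E Y) s} {C : Constraint Sg Y}
    (hmem : ⟨.ne s(t, a), C⟩ ∈ A) (hC : ConHolds M J C) :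
    evalExt hgt A M J t ≠ evalExt hgt A M J a := by
  classical
  -- The larger side comes first.
  have main : ∀ t a : Term Sg (Vars E Y) s, ⟨.ne s(t, a), C⟩ ∈ A → t = a ∨ gt s t a →
      evalExt hgt A M J t ≠ evalExt hgt A M J a := by
    clear hmem t a
    intro t
    induction t using (hgt.wf s).induction generalizing C with | _ t ih =>
    intro a hmem hta
    by_cases hfree : (Lit.ne s(t, a)).EFree
    · exact (Lit.toQF_ne_holds ..).1 (holds_of_eFree hgt hM hfree hmem hC)
    rcases hta with rfl | hta
    · exact (not_infer_bot hgt hsat hM (.reflexion t t C ∅ hmem hfree (.same t))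
        (conHolds_union.2 ⟨hC, conHolds_empty M J⟩)).elim
    obtain ⟨ht, ha⟩ := Lit.eFlat_ne.1 ((hA _ hmem).resolve_left (by simp))
    have htf : ¬ t.EFree := by
      intro ht'
      have haf : ¬ a.EFree := fun ha' => hfree ((Lit.eFree_ne _ _).2 ⟨ht', ha'⟩)
      exact hgt.irrefl _ _ (hgt.trans _ _ _ _ hta (hflat.toFree _ _ _ (.simple ha) haf ht'))
    obtain ⟨e, rfl⟩ := ht.resolve_left htf
    by_cases hr : ∃ r, Reduces gt A M J (evar e) r
    · obtain ⟨r, hr⟩ := hr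
      rw [eval_eq_of_reduces_evar hgt hflat hA hsat hM hr]
      obtain ⟨D, hmem', hD, hlt⟩ := hr
      have hf' : ¬ (Lit.eq s(evar e, r)).EFree := fun h => htf ((Lit.eFree_eq _ _).1 h).1
      have hCD : ConHolds M J (D ∪ C ∪ ∅) :=
        conHolds_union.2 ⟨conHolds_union.2 ⟨hD, hC⟩, conHolds_empty M J⟩
      obtain ⟨x', y', hmem₂, hx', hy', hxe, hye⟩ := exists_mem_of_infer hgt hflat hA hsat hM
        (.inr rfl) (.superpositionLeft (evar e) r (evar e) (evar e) a r D C ∅ hmem' hmem hf' hfree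
          hlt hta .root (.same _)) hCD hlt hta
      rw [← hxe, ← hye]
      by_cases hxy : x' = y'
      · exact ih _ hx' hCD _ hmem₂ (.inl hxy)
      rcases hgt.total s x' y' hxy with h | h
      · exact ih _ hx' hCD _ hmem₂ (.inr h)
      · rw [Sym2.eq_swap] at hmem₂
        exact (ih _ hy' hCD _ hmem₂ (.inr h)).symm
    · rw [eval_extension _ _ _ _ ht, eval_extension _ _ _ _ ha,
        value_evar hgt A M J (not_exists.1 hr)]
      intro h
      rcases eq_or_gt_of_value_eq_inr hgt A M J hflat hA ha h.symm with rfl | h'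
      exacts [hgt.irrefl _ _ hta, hgt.irrefl _ _ (hgt.trans _ _ _ _ hta h')]
  by_cases hta : t = a
  · exact main t a hmem (.inl hta)
  rcases hgt.total s t a hta with h | h
  · exact main t a hmem (.inr h)
  · rw [Sym2.eq_swap] at hmem
    exact (main a t hmem (.inr h)).symm

include hflat hA hsat hM in
theorem models_extension : Models (extension hgt A M J) (fun _ e => value hgt A M J (evar e))
    (fun s y => (extensionEmbedding hgt A M J).toFun s (J s y)) A := by
  rintro ⟨L, C⟩ hK hC
  replace hC := ((extensionEmbedding hgt A M J).conHolds_iff J C).1 hC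
  cases L with
  | bot => exact holds_of_eFree hgt hM ⟨.bot, rfl⟩ hK hC
  | eq p =>
    induction p with | _ a b =>
    refine (Lit.toQF_eq_holds ..).2 (eval_eq_of_mem hgt hM hK hC
      (fun h _ => eval_eq_of_reduces hgt hflat hA hsat hM ⟨C, hK, hC, h⟩)
      (fun h _ => eval_eq_of_reduces hgt hflat hA hsat hM ⟨C, ?_, hC, h⟩))
    rwa [Sym2.eq_swap]
  | ne p =>
    induction p with | _ a b =>
    exact (Lit.toQF_ne_holds ..).2 (eval_ne_of_mem hgt hflat hA hsat hM hK hC)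

end Saturation

end Extension

end CSC

open CSC in
theorem mainTheorem1 {S : Type u} (Sg : CSC.Signature S)
    (E Y : S → Type) [Finite (Σ s, E s)] [Finite (Σ s, Y s)]
    (gt : CSC.TermRel Sg E Y) (hgt : CSC.IsReductionOrdering gt) (hflat : CSC.OrientsFlat gt)
    (Φ : List (CSC.Lit Sg (CSC.Vars E Y))) (hΦ : ∀ L ∈ Φ, L.EFlat)
    (ψ : CSC.QF Sg Y) (hψ : CSC.Outputs gt Φ ψ) :
    CSC.IsCover (CSC.matrix Φ) ψ := by
  obtain ⟨A, hsteps, hsat, rfl⟩ := hψ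
  refine ⟨fun M I J hφ => ?_, fun θ hθ M J K hM => ?_⟩
  · rw [matrix_holds, models_iff_of_steps hgt hsteps] at hφ
    exact (outputFormula_holds M J A).2 fun K hK hC => (Lit.ofPar_holds M I J _).1 (hφ _ hK hC)
  · -- The residue is true in the extension, hence in `M`.
    let h := extensionEmbedding hgt A M J
    have hmodels := models_extension hgt hflat (flatState_of_steps hgt hflat hΦ hsteps) hsat hM
    have hθN := hθ _ _ _ (fun s z => h.toFun s (K s z))
      ((matrix_holds ..).2 ((models_iff_of_steps hgt hsteps ..).2 hmodels))
    refine (h.holds_iff (joint J K) θ).1 ?_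
    convert hθN using 3 with s x
    cases x <;> rfl
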